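/- Let $K$ be a number field with ring of integers $\mathcal O_K$, let $\mathfrak p$ be a prime ideal of $\mathcal O_K$ lying above a prime number $p$, let $q=|\mathcal O_K/\mathfrak p|$ be the cardinality of its residue field, and let $e_0$ be its ramification index over $p$. For $e\ge 1$ put $R_e=\mathcal O_K/\mathfrak p^e$, $G_e=\mathrm{SL}_2(R_e)$, $U_e=\left\{\begin{pmatrix}1&x\\0&1\end{pmatrix}: x\in R_e\right\}$ and $X_e=G_e/U_e$. For a subgroup $H\subset G_e$ set $$\chi_e(H)=\frac{|H\backslash X_e|}{[G_e:H]},$$ where $H\backslash X_e$ is the set of orbits of $H$ acting on $X_e$ by left translation. Say that $H$ has exact level $e$ if either $e>1$ and $H$ is not the full preimage in $G_e$ of its image under the reduction map $G_e\to G_{e-1}$, or $e=1$ and $H\ne G_1$. Let $H\subset G_e$ be a subgroup of exact level $e$. If $p\ge 3$ and $e\ge 2e_0^2+3e_0+4$, then $$\chi_e(H)\le q(q^2-1)\left(q^{-e}+2q^{1-e}+q^2e^{3/2}p^{-(e-3)/(6+4e_0)}\right).$$ If $p=2$ and $e>36e_0+13$, then $$\chi_e(H)\le q^{6e_0+1}(q^2-1)\left(q^{-e}+2q^{1-e}+4q^{2+e_0/2}e^{3/2}p^{-(e-37e_0)/(18+34e_0)}\right).$$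 -/

import Mathlib

open scoped NumberField MatrixGroups

/-- The upper unipotent subgroup `{(1, x; 0, 1) : x ∈ R}` of `SL₂(R)`. -/
def upperUnipotent (R : Type*) [CommRing R] : Subgroup SL(2, R) where
  carrier := {g | ∃ x : R, (g : Matrix (Fin 2) (Fin 2) R) = !![1, x; 0, 1]}
  one_mem' := ⟨0, by simp [Matrix.one_fin_two]⟩
  mul_mem' := by
    rintro a b ⟨x, hx⟩ ⟨y, hy⟩
    refine ⟨y + x, ?_⟩
    rw [Matrix.SpecialLinearGroup.coe_mul, hx, hy]
    simp
  inv_mem' := by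
    rintro a ⟨x, hx⟩
    refine ⟨-x, ?_⟩
    rw [Matrix.SpecialLinearGroup.coe_inv, hx]
    simp [Matrix.adjugate_fin_two]

section Local

variable {K : Type*} [Field K] [NumberField K]

/-- `R_e = 𝓞_K / 𝔭 ^ e`. -/
abbrev LocalRing (𝔭 : Ideal (𝓞 K)) (e : ℕ) : Type _ := 𝓞 K ⧸ 𝔭 ^ e

/-- `G_e = SL₂(R_e)`. -/
abbrev LocalSL (𝔭 : Ideal (𝓞 K)) (e : ℕ) : Type _ := SL(2, LocalRing 𝔭 e)

/-- The coset space `X_e = G_e / U_e`, with its left action of `G_e`. -/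
abbrev LocalCosets (𝔭 : Ideal (𝓞 K)) (e : ℕ) : Type _ :=
  LocalSL 𝔭 e ⧸ upperUnipotent (LocalRing 𝔭 e)

/-- The reduction map `ρ_{k,j} : G_k → G_j` for `j ≤ k`. -/
def reductionMap (𝔭 : Ideal (𝓞 K)) {j k : ℕ} (h : j ≤ k) : LocalSL 𝔭 k →* LocalSL 𝔭 j :=
  Matrix.SpecialLinearGroup.map (Ideal.Quotient.factor (Ideal.pow_le_pow_right h))

/-- `H ⊆ G_e` has exact level `e`: for `e > 1` it is not the full preimage of its image in
`G_{e-1}`, and for `e = 1` it is a proper subgroup of `G_1`. -/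
def HasExactLevel (𝔭 : Ideal (𝓞 K)) (e : ℕ) (H : Subgroup (LocalSL 𝔭 e)) : Prop :=
  (1 < e → H ≠ (H.map (reductionMap 𝔭 (Nat.sub_le e 1))).comap
      (reductionMap 𝔭 (Nat.sub_le e 1))) ∧
    (e = 1 → H ≠ ⊤)

/-- `χ_e(H) = |H \ X_e| / [G_e : H]`, where `H \ X_e` is the set of orbits of `H` acting on
`X_e` by left translation. -/
noncomputable def localChi (𝔭 : Ideal (𝓞 K)) (e : ℕ) (H : Subgroup (LocalSL 𝔭 e)) : ℝ :=
  (Nat.card (MulAction.orbitRel.Quotient H (LocalCosets 𝔭 e)) : ℝ) / (H.index : ℝ)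

end Local

/-!
Write `R = 𝓞 K ⧸ 𝔭 ^ e`, `G = SL(2, R)`, and let `U` be the upper unipotent subgroup. By
Burnside's lemma, `χ_e(H)` is the proportion of pairs `(g, u) ∈ G × U` with `g u g⁻¹ ∈ H`. If `u`
has upper right entry `x` and `v = (a, c)` is the first column of `g`, then `g u g⁻¹ = 1 + x
N(v)`, where `N(v) = (-ac, a²; -c², ac)` is nilpotent and quadratic in `v`. So for each `x ∈ R`
one has to bound the number of `v ∈ R²` with `1 + x N(v) ∈ H`.

Put `r₀ = ⌈e / 2⌉` and let `π` be a uniformizer. The `x` divisible by `π ^ r₀` form a proportion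
`q ^ (-r₀)` and are estimated trivially. For any other `x`, some power `(1 + x N(v)) ^ p ^ j = 1 +
y N(v)` has `y` of valuation between `r₀` and `r₀ + e₀ - 1`. Modulo `π ^ e` the matrices `1 + Z`
with `π ^ r₀ ∣ Z` multiply by adding the `Z`, so those lying in `H` form an additive group
(`congruenceLayer`). As `H` has exact level `e`, this group omits some matrix in the last layer `π
^ (e - 1) 𝔰𝔩₂`, and since `𝔰𝔩₂` is additively spanned by multiples of `N(1, 0)`, `N(0, 1)` and
`N(1, 1)`, it omits some `s N(v₀)` with `π ^ (e - 1) ∣ s`. An additive character `ψ` which is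
trivial on the group and nontrivial at `s N(v₀)` then reduces the problem to counting the
solutions of `ψ(y N(v)) = 1`.

On each line `w + R v₀` this is the equation `c χ(t) φ(t²) = 1` in `t`, for additive characters
`χ` and `φ` with `φ` nontrivial on the ideal generated by `π ^ (d - 1)`, where `d` is `e` minus
the valuation of `y`. Averaging over the `p ^ e` powers of the left side turns the count into
quadratic Gauss sums, each of which is estimated by Weyl differencing. This gives
`card_quadratic_le`, with a saving of about `p ^ (-d / (2 e₀))`. As `d` is at least about `e / 2 -
e₀`, the outcome (`localChi_le`) is `χ_e(H) ≤ p ^ (-e / 2) + 2 (e + 1) p ^ (1 - e / (4 e₀))`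
whenever `2 e₀ < e`, for every prime `p` including `2`, and both stated estimates follow from it.
-/

/-! ### Quadratic exponential sums over a finite ring -/

/-- Weyl differencing: the square of a quadratic exponential sum is bounded by `|R|` times the
number of shifts `b` for which the linear character `a ↦ φ (2 b a)` is trivial. -/
theorem norm_sum_quadratic_sq_le {R : Type*} [CommRing R] [Fintype R] (φ χ : AddChar R ℂ) :
    ‖∑ a, χ a * φ (a * a)‖ ^ 2 ≤
      (Fintype.card R : ℝ) * Nat.card {b : R // ∀ a, φ (2 * b * a) = 1} := by
  classical
  have hone : ∀ (ψ : AddChar R ℂ) (a : R), ψ a * starRingEnd ℂ (ψ a) = 1 := by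
    intro ψ a
    rw [Complex.mul_conj, Complex.normSq_eq_norm_sq, AddChar.norm_apply]; simp
  have key : ((‖∑ a, χ a * φ (a * a)‖ ^ 2 : ℝ) : ℂ) =
      ∑ b, (χ b * φ (b * b)) * ∑ a, φ.mulShift (2 * b) a := by
    push_cast
    rw [← Complex.mul_conj', map_sum, Finset.sum_mul_sum, Finset.sum_comm]
    have : ∀ a : R, ∑ b, χ b * φ (b * b) * starRingEnd ℂ (χ a * φ (a * a)) =
        ∑ b, χ b * φ (b * b) * φ.mulShift (2 * b) a := by
      intro a
      rw [← Equiv.sum_comp (Equiv.addRight a)]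
      refine Finset.sum_congr rfl fun b _ ↦ ?_
      simp only [Equiv.coe_addRight, AddChar.mulShift_apply, map_mul]
      rw [show (b + a) * (b + a) = b * b + a * a + 2 * b * a by ring]
      simp only [AddChar.map_add_eq_mul]
      linear_combination (χ b * φ (b * b) * φ (2 * b * a)) *
        (χ a * starRingEnd ℂ (χ a) * hone φ (a * a) + hone χ a)
    rw [Finset.sum_congr rfl fun a _ ↦ this a, Finset.sum_comm]
    simp only [Finset.mul_sum]
  have h2 : ‖∑ b, (χ b * φ (b * b)) * ∑ a, φ.mulShift (2 * b) a‖ ≤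
      ∑ b, if (∀ a, φ (2 * b * a) = 1) then (Fintype.card R : ℝ) else 0 := by
    refine (norm_sum_le _ _).trans (Finset.sum_le_sum fun b _ ↦ ?_)
    rw [AddChar.sum_eq_ite]
    have : φ.mulShift (2 * b) = 0 ↔ ∀ a, φ (2 * b * a) = 1 := by
      rw [AddChar.eq_zero_iff]; simp [AddChar.mulShift_apply]
    simp only [this]
    split_ifs <;> simp [AddChar.norm_apply]
  rw [← key, Complex.norm_real, Real.norm_of_nonneg (by positivity)] at h2
  refine h2.trans (le_of_eq ?_)
  rw [Finset.sum_ite, Finset.sum_const_zero, add_zero, Finset.sum_const, nsmul_eq_mul, mul_comm,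
    Nat.card_eq_fintype_card, Fintype.card_subtype]

/-- The mean of the powers `z ^ t`, `t < M`, of an `M`-th root of unity `z` is `1` if `z = 1` and
`0` otherwise, so the solutions of `F a = 1` are counted by averaging power sums. -/
theorem card_eq_one_mul_le {ι : Type*} [Fintype ι] (F : ι → ℂ) (M : ℕ) (hF : ∀ a, F a ^ M = 1) :
    (Nat.card {a // F a = 1} : ℝ) * M ≤ ∑ t ∈ Finset.range M, ‖∑ a, F a ^ t‖ := by
  classical
  have h1 : ∀ a, ∑ t ∈ Finset.range M, F a ^ t = if F a = 1 then (M : ℂ) else 0 := by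
    intro a
    split_ifs with h
    · simp [h]
    · rw [geom_sum_eq h, hF]; simp
  have h2 : ∑ t ∈ Finset.range M, ∑ a, F a ^ t = ((Nat.card {a // F a = 1} * M : ℝ) : ℂ) := by
    rw [Finset.sum_comm, Finset.sum_congr rfl fun a _ ↦ h1 a, Finset.sum_ite,
      Finset.sum_const_zero, add_zero, Finset.sum_const, nsmul_eq_mul,
      Nat.card_eq_fintype_card, Fintype.card_subtype]
    push_cast; rfl
  calc (Nat.card {a // F a = 1} : ℝ) * M = ‖((Nat.card {a // F a = 1} * M : ℝ) : ℂ)‖ := by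
        rw [Complex.norm_real, Real.norm_of_nonneg (by positivity)]
    _ ≤ _ := by rw [← h2]; exact norm_sum_le _ _

/-! ### Finite chain rings -/

/-- `R` is a finite chain ring of length `e` with uniformizer `π` and residue field of order `q`:
every element is a unit times a power of `π`, and `|R| = q ^ e`. Of the orders of the ideals `π ^
m R`, only the upper bound `q ^ (e - m)` is recorded. -/
structure IsFiniteChainRing (R : Type*) [CommRing R] (π : R) (e q : ℕ) : Prop where
  pow_eq_zero : π ^ e = 0
  exists_unit_mul_pow : ∀ x : R, ∃ (u : Rˣ) (k : ℕ), x = u * π ^ k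
  card_eq : Nat.card R = q ^ e
  card_dvd_le : ∀ m ≤ e, Nat.card {x : R // π ^ m ∣ x} ≤ q ^ (e - m)

/-- Each power `p ^ v` with `v < N` divides exactly `p ^ (N - v)` of the integers in `[0, p ^ N)`.
For `t ≠ 0` the inner sum dominates the `p`-part of `t`. -/
theorem sum_pow_dvd_eq {p : ℕ} (hp : p.Prime) (N : ℕ) :
    ∑ t ∈ Finset.range (p ^ N), ∑ v ∈ Finset.range N, (if p ^ v ∣ t then (p : ℝ) ^ v else 0) =
      N * (p : ℝ) ^ N := by
  rw [Finset.sum_comm]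
  have : ∀ v ∈ Finset.range N, ∑ t ∈ Finset.range (p ^ N),
      (if p ^ v ∣ t then (p : ℝ) ^ v else 0) = (p : ℝ) ^ N := by
    intro v hv
    have hv := (Finset.mem_range.1 hv).le
    have hc : ((Finset.range (p ^ N)).filter (p ^ v ∣ ·)).card = p ^ (N - v) := by
      have : (Finset.range (p ^ N)).filter (p ^ v ∣ ·) =
          (Finset.range (p ^ (N - v))).image (p ^ v * ·) := by
        ext t
        simp only [Finset.mem_filter, Finset.mem_range, Finset.mem_image]
        have hN : p ^ N = p ^ v * p ^ (N - v) := by rw [← pow_add]; congr 1; omega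
        constructor
        · rintro ⟨h1, s, rfl⟩
          exact ⟨s, by rw [hN] at h1; exact lt_of_mul_lt_mul_left h1 (Nat.zero_le _), rfl⟩
        · rintro ⟨s, hs, rfl⟩
          exact ⟨by rw [hN]; exact Nat.mul_lt_mul_of_pos_left hs (pow_pos hp.pos _),
            dvd_mul_right _ _⟩
      rw [this, Finset.card_image_of_injective _
        (mul_right_injective₀ (pow_pos hp.pos _).ne'), Finset.card_range]
    rw [Finset.sum_ite, Finset.sum_const_zero, add_zero, Finset.sum_const, hc, nsmul_eq_mul]
    push_cast
    rw [← pow_add]; congr 1; omega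
  rw [Finset.sum_congr rfl this]; simp

namespace IsFiniteChainRing

variable {R : Type*} [CommRing R] {π : R} {e q p e₀ : ℕ}

theorem cast_pow_eq_zero (hR : IsFiniteChainRing R π e q) (he₀ : 1 ≤ e₀) {u₀ : Rˣ}
    (hpπ : (p : R) = u₀ * π ^ e₀) : (p : R) ^ e = 0 := by
  rw [hpπ, mul_pow, ← pow_mul, mul_comm e₀, pow_mul, hR.pow_eq_zero, zero_pow (by omega), mul_zero]

/-- An integer prime to `p` is a unit, because `p` is nilpotent. -/
theorem isUnit_natCast (hR : IsFiniteChainRing R π e q) (hp : p.Prime) (he₀ : 1 ≤ e₀) {u₀ : Rˣ}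
    (hpπ : (p : R) = u₀ * π ^ e₀) {m : ℕ} (hm : ¬ p ∣ m) : IsUnit (m : R) := by
  have h1 : Nat.Coprime m (p ^ e) := ((Nat.Prime.coprime_iff_not_dvd hp).2 hm).symm.pow_right e
  have h2 := (Nat.isCoprime_iff_coprime.2 h1).map (Int.castRingHom R)
  simp only [eq_intCast, Int.cast_natCast, Nat.cast_pow] at h2
  rw [Int.cast_pow, Int.cast_natCast, hR.cast_pow_eq_zero he₀ hpπ] at h2
  exact isCoprime_zero_right.1 h2

/-- A character which is nontrivial on `π ^ (d - 1) R` is nontrivial on every ideal containing it,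
hence on `s b R` unless `s b` has valuation at least `d`. -/
theorem dvd_of_forall_apply_eq_one (hR : IsFiniteChainRing R π e q) {φ : AddChar R ℂ} {d w : ℕ}
    (hd : 1 ≤ d) {b₀ : R} (hb : φ (π ^ (d - 1) * b₀) ≠ 1) {u : Rˣ} {s b : R}
    (hs : s = u * π ^ w) (h : ∀ a, φ (s * b * a) = 1) : π ^ (d - w) ∣ b := by
  obtain ⟨u', k, rfl⟩ := hR.exists_unit_mul_pow b
  by_cases hk : d ≤ k + w
  · exact (pow_dvd_pow π (by omega)).mul_left _
  · refine absurd (h (↑(u * u')⁻¹ * π ^ (d - 1 - k - w) * b₀)) ?_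
    convert hb using 3
    have : π ^ (d - 1) = π ^ w * π ^ k * π ^ (d - 1 - k - w) := by
      rw [← pow_add, ← pow_add]; congr 1; omega
    rw [this, hs]
    have hu : (↑(u * u') : R) * ↑(u * u')⁻¹ = 1 := Units.mul_inv _
    rw [Units.val_mul] at hu
    linear_combination (π ^ w * π ^ k * π ^ (d - 1 - k - w) * b₀) * hu

/-- The count of shifts in a Gauss sum of frequency `t`, where `p ^ v ∣ t` and `p ^ w ∣ 2 t`, in
terms of `p` only; it rests on `p ≤ q` and `1 ≤ e₀`. When `d ≤ w e₀` the count is trivial, and the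
right side is at least `q ^ e`. -/
theorem pow_sub_le_mul_rpow (hp : p.Prime) (hpq : p ≤ q) (he₀ : 1 ≤ e₀) {d w v : ℕ} (hde : d ≤ e)
    (hw : w ≤ v + 1) :
    (q : ℝ) ^ (e - (d - w * e₀)) ≤
      (q : ℝ) ^ e * ((p : ℝ) ^ ((1 - (d : ℝ) / e₀) / 2) * (p : ℝ) ^ v) ^ 2 := by
  have hp0 : (0 : ℝ) < p := by exact_mod_cast hp.pos
  have hp1 : (1 : ℝ) ≤ p := by exact_mod_cast hp.one_le
  have hpq' : (p : ℝ) ≤ q := by exact_mod_cast hpq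
  have hq0 : (0 : ℝ) < q := hp0.trans_le hpq'
  have he0 : (1 : ℝ) ≤ e₀ := by exact_mod_cast he₀
  set D := d - w * e₀ with hD
  have hDr : (d : ℝ) - w * e₀ ≤ D := by
    have : d ≤ D + w * e₀ := by omega
    have : (d : ℝ) ≤ D + w * e₀ := by exact_mod_cast this
    linarith
  have h1 : ((p : ℝ) ^ ((1 - (d : ℝ) / e₀) / 2) * (p : ℝ) ^ v) ^ 2 =
      (p : ℝ) ^ (1 - (d : ℝ) / e₀ + 2 * v) := by
    rw [← Real.rpow_natCast (p : ℝ) v, ← Real.rpow_add hp0, ← Real.rpow_natCast _ 2,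
      ← Real.rpow_mul hp0.le]
    congr 1; push_cast; ring
  rw [h1]
  have h2 : (p : ℝ) ^ (-(D : ℝ)) ≤ (p : ℝ) ^ (1 - (d : ℝ) / e₀ + 2 * v) := by
    apply Real.rpow_le_rpow_of_exponent_le hp1
    have h3 : ((d : ℝ) - w * e₀) / e₀ ≤ D := by
      rw [div_le_iff₀ (by linarith)]
      nlinarith [Nat.cast_nonneg (α := ℝ) D]
    rw [sub_div, mul_div_assoc, div_self (by linarith), mul_one] at h3
    have : (w : ℝ) ≤ v + 1 := by exact_mod_cast hw
    linarith [Nat.cast_nonneg (α := ℝ) v]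
  refine le_trans ?_ (mul_le_mul_of_nonneg_left h2 (by positivity))
  rw [Real.rpow_neg hp0.le, Real.rpow_natCast, pow_sub₀ _ hq0.ne' (by omega)]
  gcongr

/-- Count of the solutions of a quadratic equation in one variable, detected by additive
characters. The hypothesis on `φ` says that the leading coefficient is primitive at level `d`. -/
theorem card_quadratic_le [Fintype R] (hR : IsFiniteChainRing R π e q) (hp : p.Prime)
    (hpq : p ≤ q) (he₀ : 1 ≤ e₀) {u₀ : Rˣ} (hpπ : (p : R) = u₀ * π ^ e₀) (φ χ : AddChar R ℂ)
    {c : ℂ} (hc : c ^ p ^ e = 1) {d : ℕ} (hd : 1 ≤ d) (hde : d ≤ e) {b₀ : R}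
    (hb : φ (π ^ (d - 1) * b₀) ≠ 1) :
    (Nat.card {a : R // c * (χ a * φ (a * a)) = 1} : ℝ) ≤
      (q : ℝ) ^ e * ((e + 1) * (p : ℝ) ^ ((1 - (d : ℝ) / e₀) / 2)) := by
  have hp0 : (0 : ℝ) < p := by exact_mod_cast hp.pos
  have hp1 : (1 : ℝ) ≤ p := by exact_mod_cast hp.one_le
  have hq0 : (0 : ℝ) < q := by exact_mod_cast hp.pos.trans_le hpq
  have hcard : (Fintype.card R : ℝ) = (q : ℝ) ^ e := by
    rw [← Nat.card_eq_fintype_card, hR.card_eq]; push_cast; rfl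
  have hroot : ∀ (ψ : AddChar R ℂ) (a : R), ψ a ^ p ^ e = 1 := by
    intro ψ a
    rw [← AddChar.map_nsmul_eq_pow, nsmul_eq_mul, Nat.cast_pow, hR.cast_pow_eq_zero he₀ hpπ,
      zero_mul, AddChar.map_zero_eq_one]
  set T : ℝ := (p : ℝ) ^ ((1 - (d : ℝ) / e₀) / 2) with hT
  have hT0 : 0 < T := Real.rpow_pos_of_pos hp0 _
  have hc1 : ‖c‖ = 1 := by
    have := congrArg norm hc
    rw [norm_pow, norm_one] at this
    exact (pow_eq_one_iff_of_nonneg (norm_nonneg c) (pow_pos hp.pos e).ne').1 this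
  have hmain := card_eq_one_mul_le (fun a : R ↦ c * (χ a * φ (a * a))) (p ^ e)
    (fun a ↦ by simp only [mul_pow, hc, hroot, mul_one])
  have hterm : ∀ t ∈ Finset.range (p ^ e), t ≠ 0 → ‖∑ a, (c * (χ a * φ (a * a))) ^ t‖ ≤
      (q : ℝ) ^ e * T * ∑ v ∈ Finset.range e, (if p ^ v ∣ t then (p : ℝ) ^ v else 0) := by
    intro t ht ht0
    obtain ⟨w, m, hm, htm⟩ := Nat.exists_eq_pow_mul_and_not_dvd
      (n := 2 * t) (by omega) p hp.ne_one
    -- `2 t` has at most one factor `p` more than `t`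
    obtain ⟨v, hv, hvt, hvw⟩ : ∃ v < e, p ^ v ∣ t ∧ w ≤ v + 1 := by
      have h1 : p ^ (w - 1) ∣ t := by
        rcases Nat.eq_zero_or_pos w with rfl | hw
        · simp
        · have h2 : p ^ w ∣ 2 * t := ⟨m, htm⟩
          by_cases h : p = 2
          · subst h
            obtain ⟨w, rfl⟩ := Nat.exists_eq_succ_of_ne_zero hw.ne'
            rw [Nat.pow_succ'] at h2
            exact Nat.dvd_of_mul_dvd_mul_left two_pos h2
          · exact (pow_dvd_pow p (Nat.sub_le w 1)).trans
              ((((Nat.coprime_primes hp Nat.prime_two).2 h).pow_left w).dvd_of_dvd_mul_left h2)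
      refine ⟨w - 1, ?_, h1, by omega⟩
      have h2 := (Nat.le_of_dvd (Nat.pos_of_ne_zero ht0) h1).trans_lt (Finset.mem_range.1 ht)
      exact (Nat.pow_lt_pow_iff_right hp.one_lt).1 h2
    -- raising the characters to the power `t` gives a Gauss sum of the same shape
    have hsum : ‖∑ a, (c * (χ a * φ (a * a))) ^ t‖ = ‖∑ a, (χ ^ t) a * (φ ^ t) (a * a)‖ := by
      simp only [mul_pow, ← Finset.mul_sum, norm_mul, norm_pow, hc1, one_pow, one_mul,
        AddChar.pow_apply]
    have hs : ((2 * t : ℕ) : R) = ((hR.isUnit_natCast hp he₀ hpπ hm).unit * u₀ ^ w : Rˣ) *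
        π ^ (w * e₀) := by
      rw [htm]; push_cast
      rw [hpπ, mul_pow, ← pow_mul, mul_comm e₀]; simp only [IsUnit.unit_spec]; ring
    have hle : Nat.card {b : R // ∀ a, (φ ^ t) (2 * b * a) = 1} ≤ q ^ (e - (d - w * e₀)) := by
      refine le_trans ?_ (hR.card_dvd_le (d - w * e₀) (by omega))
      refine Nat.card_le_card_of_injective (fun b ↦ ⟨b.1, ?_⟩) fun a b h ↦ Subtype.ext ?_
      · refine hR.dvd_of_forall_apply_eq_one hd hb hs fun a ↦ ?_
        have h := b.2 a
        rw [AddChar.pow_apply, ← AddChar.map_nsmul_eq_pow, nsmul_eq_mul] at h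
        refine Eq.trans (congrArg φ ?_) h
        push_cast; ring
      · simpa using h
    have hsq := norm_sum_quadratic_sq_le (φ ^ t) (χ ^ t)
    have hle' : (Nat.card {b : R // ∀ a, (φ ^ t) (2 * b * a) = 1} : ℝ) ≤
        (q : ℝ) ^ (e - (d - w * e₀)) := by exact_mod_cast hle
    have hbound : ‖∑ a, (χ ^ t) a * (φ ^ t) (a * a)‖ ≤ (q : ℝ) ^ e * (T * (p : ℝ) ^ v) := by
      refine le_of_sq_le_sq ?_ (by positivity)
      refine hsq.trans ?_
      rw [hcard, mul_pow, sq ((q : ℝ) ^ e), mul_assoc]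
      exact mul_le_mul_of_nonneg_left
        (hle'.trans (pow_sub_le_mul_rpow hp hpq he₀ hde hvw)) (by positivity)
    rw [hsum]
    refine hbound.trans ?_
    rw [mul_assoc]
    gcongr
    refine le_trans ?_ (Finset.single_le_sum (f := fun v ↦ if p ^ v ∣ t then (p : ℝ) ^ v else 0)
      (fun i _ ↦ by positivity) (Finset.mem_range.2 hv))
    simp [hvt]
  have hzero : ‖∑ a : R, (c * (χ a * φ (a * a))) ^ 0‖ ≤ (q : ℝ) ^ e * T * (p : ℝ) ^ e := by
    simp only [pow_zero, Finset.sum_const, Finset.card_univ, nsmul_eq_mul, mul_one]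
    rw [Complex.norm_natCast, hcard, mul_assoc]
    refine le_mul_of_one_le_right (by positivity) ?_
    rw [hT, ← Real.rpow_natCast, ← Real.rpow_add hp0]
    refine Real.one_le_rpow hp1 ?_
    have : (d : ℝ) / e₀ ≤ e :=
      (div_le_self (by positivity) (by exact_mod_cast he₀)).trans (by exact_mod_cast hde)
    have : (0 : ℝ) ≤ e := by positivity
    linarith
  have hall : ∑ t ∈ Finset.range (p ^ e), ‖∑ a, (c * (χ a * φ (a * a))) ^ t‖ ≤
      (q : ℝ) ^ e * T * (p : ℝ) ^ e + (q : ℝ) ^ e * T * (e * (p : ℝ) ^ e) := by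
    rw [← sum_pow_dvd_eq hp e, Finset.mul_sum]
    have h0 : 0 ∈ Finset.range (p ^ e) := Finset.mem_range.2 (pow_pos hp.pos e)
    rw [← Finset.add_sum_erase _ _ h0]
    refine add_le_add hzero ?_
    refine (Finset.sum_le_sum fun t ht ↦ hterm t (Finset.mem_of_mem_erase ht)
      (Finset.ne_of_mem_erase ht)).trans ?_
    refine Finset.sum_le_sum_of_subset_of_nonneg (Finset.erase_subset _ _) fun t _ _ ↦ ?_
    positivity
  have hpe : (0 : ℝ) < (p : ℝ) ^ e := by positivity
  refine le_of_mul_le_mul_right ?_ hpe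
  have := hmain.trans hall
  push_cast at this
  linarith

end IsFiniteChainRing

/-! ### Orbits on a coset space and unipotent elements -/

/-- Burnside's lemma for `H` acting on `G ⧸ U`: the coset `g U` is fixed by `h` exactly when `h =
g u g⁻¹` for some `u ∈ U`. -/
theorem card_orbits_mul_card_mul_card_le {G : Type*} [Group G] [Finite G] (H U : Subgroup G) :
    Nat.card (MulAction.orbitRel.Quotient H (G ⧸ U)) * Nat.card H * Nat.card U ≤
      Nat.card {gu : G × U // gu.1 * gu.2 * gu.1⁻¹ ∈ H} := by
  classical
  have : Fintype G := Fintype.ofFinite G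
  have hburn := MulAction.sum_card_fixedBy_eq_card_orbits_mul_card_group H (G ⧸ U)
  have hfib : ∀ h : H, Fintype.card (MulAction.fixedBy (G ⧸ U) h) * Nat.card U =
      Nat.card ((QuotientGroup.mk : G → G ⧸ U) ⁻¹' MulAction.fixedBy (G ⧸ U) h) := by
    intro h
    rw [Nat.card_congr (QuotientGroup.preimageMkEquivSubgroupProdSet U _), Nat.card_prod,
      mul_comm, Nat.card_eq_fintype_card (α := MulAction.fixedBy (G ⧸ U) h)]
  rw [Nat.card_eq_fintype_card, Nat.card_eq_fintype_card (α := H)]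
  refine (congrArg (· * Nat.card U) hburn.symm).trans_le ?_
  simp only [Finset.sum_mul, hfib]
  rw [← Nat.card_sigma]
  have hmem : ∀ (h : H) (g : G), (g : G ⧸ U) ∈ MulAction.fixedBy (G ⧸ U) h →
      g⁻¹ * h * g ∈ U := by
    intro h g hg
    have h1 : ((h * g : G) : G ⧸ U) = (g : G ⧸ U) := hg
    have h2 := U.inv_mem (QuotientGroup.eq.1 h1)
    convert h2 using 1
    group
  refine Nat.card_le_card_of_injective
    (fun z ↦ ⟨(z.2.1, ⟨_, hmem z.1 z.2.1 z.2.2⟩), by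
      convert z.1.2 using 1; simp only; group⟩) ?_
  rintro ⟨h, g, hg⟩ ⟨h', g', hg'⟩ heq
  simp only [Subtype.mk.injEq, Prod.mk.injEq] at heq
  obtain ⟨rfl, h2⟩ := heq
  have : h = h' := Subtype.ext (by simpa using h2)
  subst this
  rfl

section Unipotent

variable {R : Type*} [CommRing R]

/-- The matrix `N(v) = (-ac, a²; -c², ac)` of square zero attached to `v = (a, c)`. It is the
conjugate `g E g⁻¹` of the elementary matrix `E = (0, 1; 0, 0)` by any `g` of determinant one with
first column `v`. -/
def nilpotentOf (v : R × R) : Matrix (Fin 2) (Fin 2) R :=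
  !![-(v.1 * v.2), v.1 * v.1; -(v.2 * v.2), v.1 * v.2]

/-- The bilinear polarization of the quadratic map `nilpotentOf`. -/
def nilpotentPolar (v w : R × R) : Matrix (Fin 2) (Fin 2) R :=
  !![-(v.1 * w.2 + w.1 * v.2), 2 * (v.1 * w.1); -(2 * (v.2 * w.2)), v.1 * w.2 + w.1 * v.2]

theorem nilpotentOf_add_smul (w v : R × R) (a : R) :
    nilpotentOf (w + a • v) =
      nilpotentOf w + (a • nilpotentPolar w v + (a * a) • nilpotentOf v) := by
  ext i j
  fin_cases i <;> fin_cases j <;> simp [nilpotentOf, nilpotentPolar] <;> ring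

/-- The unipotent matrix `1 + x N(v)`. It has determinant one for every `v ∈ R²`, unimodular or
not. -/
def unipotentOf (x : R) (v : R × R) : SL(2, R) :=
  ⟨1 + x • nilpotentOf v, by
    rw [Matrix.det_fin_two]; simp [nilpotentOf]; ring⟩

theorem unipotentOf_pow (x : R) (v : R × R) (n : ℕ) :
    unipotentOf x v ^ n = unipotentOf (n * x) v := by
  induction n with
  | zero => rw [pow_zero]; ext i j; simp [unipotentOf]
  | succ n ih =>
    rw [pow_succ, ih]
    ext i j
    rw [Matrix.SpecialLinearGroup.coe_mul]
    fin_cases i <;> fin_cases j <;>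
      simp [unipotentOf, nilpotentOf, Matrix.mul_apply, Fin.sum_univ_two] <;> ring

/-- The first column of a matrix in `SL(2, R)`. -/
def firstCol (g : SL(2, R)) : R × R := (g 0 0, g 1 0)

theorem conj_eq_unipotentOf (g u : SL(2, R)) {x : R}
    (hu : (u : Matrix (Fin 2) (Fin 2) R) = !![1, x; 0, 1]) :
    g * u * g⁻¹ = unipotentOf x (firstCol g) := by
  have hdet := g.2
  rw [Matrix.det_fin_two] at hdet
  rw [mul_inv_eq_iff_eq_mul]
  ext i j
  rw [Matrix.SpecialLinearGroup.coe_mul, Matrix.SpecialLinearGroup.coe_mul, hu]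
  fin_cases i <;> fin_cases j <;>
    simp [unipotentOf, nilpotentOf, firstCol, Matrix.mul_apply, Fin.sum_univ_two]
  · ring
  · linear_combination (-x * g 0 0) * hdet
  · ring
  · linear_combination (-x * g 1 0) * hdet

/-- Two matrices in `SL(2, R)` with the same first column differ by an upper unipotent matrix. -/
theorem inv_mul_apply_of_firstCol_eq {g g' : SL(2, R)} (h : firstCol g = firstCol g') :
    ((g⁻¹ * g' : SL(2, R)) : Matrix (Fin 2) (Fin 2) R) = !![1, (g⁻¹ * g') 0 1; 0, 1] := by
  have hdet := g.2
  have hdet' := g'.2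
  rw [Matrix.det_fin_two] at hdet hdet'
  simp only [firstCol, Prod.mk.injEq] at h
  obtain ⟨h0, h1⟩ := h
  ext i j
  rw [Matrix.SpecialLinearGroup.coe_mul, Matrix.SpecialLinearGroup.coe_inv,
    Matrix.adjugate_fin_two]
  fin_cases i <;> fin_cases j <;>
    simp [Matrix.mul_apply, Fin.sum_univ_two]
  · linear_combination hdet - g 1 1 * h0 + g 0 1 * h1
  · linear_combination g 1 0 * h0 - g 0 0 * h1
  · linear_combination hdet' - g' 0 1 * h1 + g' 1 1 * h0

/-- The nonempty fibres of the first column map are cosets of the upper unipotent group, hence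
have at most `|R|` elements. -/
theorem card_firstCol_mem_le [Finite R] (S : Set (R × R)) :
    Nat.card {g : SL(2, R) // firstCol g ∈ S} ≤ Nat.card S * Nat.card R := by
  rw [← Nat.card_prod]
  have hinv : ∀ g : SL(2, R), firstCol (Function.invFun firstCol (firstCol g)) = firstCol g :=
    fun g ↦ Function.invFun_eq ⟨g, rfl⟩
  refine Nat.card_le_card_of_injective
    (fun g ↦ (⟨firstCol g.1, g.2⟩, ((Function.invFun firstCol (firstCol g.1))⁻¹ * g.1) 0 1)) ?_
  rintro ⟨g, hg⟩ ⟨g', hg'⟩ h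
  simp only [Prod.mk.injEq, Subtype.mk.injEq] at h
  obtain ⟨h1, h2⟩ := h
  rw [Subtype.mk.injEq, ← mul_right_inj (Function.invFun firstCol (firstCol g))⁻¹]
  apply Subtype.ext
  have e1 := inv_mul_apply_of_firstCol_eq (hinv g)
  have e2 := inv_mul_apply_of_firstCol_eq ((congrArg _ (congrArg _ h1)).trans (hinv g'))
  rw [← h1] at h2
  exact (e1.trans (by rw [h2])).trans e2.symm

theorem card_le_card_upperUnipotent [Finite R] : Nat.card R ≤ Nat.card (upperUnipotent R) := by
  refine Nat.card_le_card_of_injective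
    (fun x ↦ ⟨⟨!![1, x; 0, 1], by simp [Matrix.det_fin_two]⟩, x, rfl⟩) fun x y h ↦ ?_
  have := congrArg (fun u : upperUnipotent R ↦ (u : SL(2, R)) 0 1) h
  simpa using this

/-- Matrices with a unit in the upper left corner are determined by three free entries. -/
theorem card_units_mul_le_card_SL [Finite R] :
    Nat.card Rˣ * (Nat.card R * Nat.card R) ≤ Nat.card SL(2, R) := by
  rw [← Nat.card_prod, ← Nat.card_prod]
  refine Nat.card_le_card_of_injective
    (fun z ↦ ⟨!![(z.1 : R), z.2.1; z.2.2, ↑z.1⁻¹ * (1 + z.2.1 * z.2.2)], by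
      rw [Matrix.det_fin_two_of, ← mul_assoc, Units.mul_inv]; ring⟩) ?_
  rintro ⟨a, b, c⟩ ⟨a', b', c'⟩ h
  have h0 := congrArg (fun u : SL(2, R) ↦ u 0 0) h
  have h1 := congrArg (fun u : SL(2, R) ↦ u 0 1) h
  have h2 := congrArg (fun u : SL(2, R) ↦ u 1 0) h
  simp at h0 h1 h2
  simp [h1, h2, Units.ext h0]

theorem card_orbits_mul_le_sum [Fintype R] (H : Subgroup SL(2, R)) :
    Nat.card (MulAction.orbitRel.Quotient H (SL(2, R) ⧸ upperUnipotent R)) * Nat.card H *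
      Nat.card R ≤ ∑ x : R, Nat.card {g : SL(2, R) // unipotentOf x (firstCol g) ∈ H} := by
  refine (Nat.mul_le_mul_left _ card_le_card_upperUnipotent).trans
    ((card_orbits_mul_card_mul_card_le H (upperUnipotent R)).trans ?_)
  rw [← Nat.card_sigma]
  have hu : ∀ u : upperUnipotent R, ((u : SL(2, R)) : Matrix (Fin 2) (Fin 2) R) =
      !![1, (u : SL(2, R)) 0 1; 0, 1] := by
    rintro ⟨u, x, hx⟩
    simp [hx]
  refine Nat.card_le_card_of_injective
    (fun z ↦ ⟨(z.1.2 : SL(2, R)) 0 1, z.1.1, by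
      rw [← conj_eq_unipotentOf z.1.1 z.1.2 (hu z.1.2)]; exact z.2⟩) ?_
  rintro ⟨⟨g, u⟩, h⟩ ⟨⟨g', u'⟩, h'⟩ heq
  rw [Sigma.mk.inj_iff] at heq
  obtain ⟨h1, h2⟩ := heq
  have hg : g = g' := by
    simp only at h1 h2
    rw [Subtype.heq_iff_coe_eq (by simp [h1])] at h2
    exact h2
  have huu : u = u' := Subtype.ext (Subtype.ext (by rw [hu u, hu u']; simp only at h1; rw [h1]))
  subst hg huu
  rfl

end Unipotent

/-! ### The congruence layer of a subgroup and counting over lines -/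

section CongruenceLayer

variable {R : Type*} [CommRing R]

theorem mul_eq_zero_of_pow_dvd {π : R} {r e : ℕ} (hre : e ≤ 2 * r) (hπ : π ^ e = 0) {a b : R}
    (ha : π ^ r ∣ a) (hb : π ^ r ∣ b) : a * b = 0 := by
  have h := mul_dvd_mul ha hb
  rw [← pow_add, ← two_mul] at h
  exact zero_dvd_iff.1 (hπ ▸ (pow_dvd_pow π hre).trans h)

theorem matrix_mul_eq_zero_of_pow_dvd {π : R} {r e : ℕ} (hre : e ≤ 2 * r) (hπ : π ^ e = 0)
    {Z W : Matrix (Fin 2) (Fin 2) R} (hZ : ∀ i j, π ^ r ∣ Z i j) (hW : ∀ i j, π ^ r ∣ W i j) :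
    Z * W = 0 := by
  ext i j
  rw [Matrix.mul_apply, Matrix.zero_apply]
  exact Finset.sum_eq_zero fun k _ ↦ mul_eq_zero_of_pow_dvd hre hπ (hZ i k) (hW k j)

/-- The matrices `Z` divisible by `π ^ r` with `1 + Z ∈ H`. Products of two such matrices vanish,
as `π ^ (2 r) = 0`, so that `(1 + Z) (1 + W) = 1 + (Z + W)` and they form an additive group. -/
def congruenceLayer (π : R) {r e : ℕ} (hre : e ≤ 2 * r) (hπ : π ^ e = 0) (H : Subgroup SL(2, R)) :
    AddSubgroup (Matrix (Fin 2) (Fin 2) R) where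
  carrier := {Z | (∀ i j, π ^ r ∣ Z i j) ∧ ∃ h ∈ H, (h : Matrix (Fin 2) (Fin 2) R) = 1 + Z}
  zero_mem' := ⟨fun _ _ ↦ dvd_zero _, 1, H.one_mem, by simp⟩
  add_mem' := by
    rintro Z W ⟨hZ, h, hh, hhZ⟩ ⟨hW, k, hk, hkW⟩
    refine ⟨fun i j ↦ dvd_add (hZ i j) (hW i j), h * k, H.mul_mem hh hk, ?_⟩
    rw [Matrix.SpecialLinearGroup.coe_mul, hhZ, hkW, add_mul, mul_add, mul_add,
      matrix_mul_eq_zero_of_pow_dvd hre hπ hZ hW]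
    simp; abel
  neg_mem' := by
    rintro Z ⟨hZ, h, hh, hhZ⟩
    refine ⟨fun i j ↦ (dvd_neg.2 (hZ i j)), h⁻¹, H.inv_mem hh, ?_⟩
    have h1 : (h : Matrix (Fin 2) (Fin 2) R) * (h⁻¹ : SL(2, R)) = 1 := by
      rw [← Matrix.SpecialLinearGroup.coe_mul, mul_inv_cancel, Matrix.SpecialLinearGroup.coe_one]
    have h2 : (1 + -Z) * (h : Matrix (Fin 2) (Fin 2) R) = 1 := by
      have := matrix_mul_eq_zero_of_pow_dvd hre hπ hZ hZ
      rw [hhZ, add_mul, mul_add, mul_add, neg_mul, neg_mul, this]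
      simp
    calc ((h⁻¹ : SL(2, R)) : Matrix (Fin 2) (Fin 2) R)
        = ((1 + -Z) * (h : Matrix (Fin 2) (Fin 2) R)) * (h⁻¹ : SL(2, R)) := by rw [h2, one_mul]
      _ = 1 + -Z := by rw [mul_assoc, h1, mul_one]

theorem smul_nilpotentOf_mem {π : R} {r e : ℕ} (hre : e ≤ 2 * r) (hπ : π ^ e = 0)
    {H : Subgroup SL(2, R)} {y : R} (hy : π ^ r ∣ y) {v : R × R} (h : unipotentOf y v ∈ H) :
    y • nilpotentOf v ∈ congruenceLayer π hre hπ H :=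
  ⟨fun i j ↦ hy.trans (dvd_mul_right y (nilpotentOf v i j)), unipotentOf y v, h, rfl⟩

/-- If `H` omits an element `k` congruent to `1` modulo `π ^ (e - 1)`, it omits a unipotent one:
`k - 1` has trace zero, hence is a sum of multiples of `N(1, 1)`, `N(1, 0)` and `N(0, 1)`. -/
theorem exists_smul_nilpotentOf_notMem {π : R} {r e : ℕ} (hre : e ≤ 2 * r) (hr : r ≤ e - 1)
    (hπ : π ^ e = 0) {H : Subgroup SL(2, R)} {k : SL(2, R)} (hk : k ∉ H)
    (hkπ : ∀ i j, π ^ (e - 1) ∣ ((k : Matrix (Fin 2) (Fin 2) R) - 1) i j) :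
    ∃ (v : R × R) (s : R), (π ^ (e - 1) * s) • nilpotentOf v ∉ congruenceLayer π hre hπ H := by
  by_contra! hall
  set Z : Matrix (Fin 2) (Fin 2) R := (k : Matrix (Fin 2) (Fin 2) R) - 1 with hZ
  have hkZ : (k : Matrix (Fin 2) (Fin 2) R) = 1 + Z := by rw [hZ]; abel
  have hZZ : ∀ i j k l, Z i j * Z k l = 0 := fun i j k l ↦
    mul_eq_zero_of_pow_dvd (by omega) hπ (hkπ i j) (hkπ k l)
  -- the determinant condition is linear on the last layer
  have htr : Z 1 1 = - Z 0 0 := by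
    have hdet := k.2
    rw [hkZ, Matrix.det_fin_two] at hdet
    simp only [Matrix.add_apply, Matrix.one_apply_eq, ne_eq, zero_ne_one, not_false_eq_true,
      Matrix.one_apply_ne, one_ne_zero] at hdet
    linear_combination hdet - hZZ 0 0 1 1 + hZZ 0 1 1 0
  obtain ⟨α, hα⟩ := hkπ 0 0
  obtain ⟨β, hβ⟩ := hkπ 0 1
  obtain ⟨γ, hγ⟩ := hkπ 1 0
  have hdecomp : Z = (π ^ (e - 1) * -α) • nilpotentOf (1, 1) +
      ((π ^ (e - 1) * (α + β)) • nilpotentOf (1, 0) +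
        (π ^ (e - 1) * (α - γ)) • nilpotentOf (0, 1)) := by
    ext i j
    fin_cases i <;> fin_cases j <;> simp [nilpotentOf, hα, hβ, hγ, htr] <;> ring
  have hmem : Z ∈ congruenceLayer π hre hπ H := by
    rw [hdecomp]
    exact add_mem (hall _ _) (add_mem (hall _ _) (hall _ _))
  obtain ⟨-, h, hh, hhZ⟩ := hmem
  exact hk ((Subtype.ext (hhZ.trans hkZ.symm) : h = k) ▸ hh)

theorem exists_addChar_eq_one_of_notMem {A : Type*} [AddCommGroup A] [Finite A]
    (M : AddSubgroup A) {a : A} (ha : a ∉ M) :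
    ∃ ψ : AddChar A ℂ, (∀ m ∈ M, ψ m = 1) ∧ ψ a ≠ 1 := by
  obtain ⟨ψ, hψ⟩ := AddChar.exists_apply_ne_zero (a := (a : A ⧸ M)).2
    (by rwa [Ne, QuotientAddGroup.eq_zero_iff])
  refine ⟨ψ.compAddMonoidHom (QuotientAddGroup.mk' M), fun m hm ↦ ?_, hψ⟩
  rw [AddChar.compAddMonoidHom_apply, QuotientAddGroup.mk'_apply,
    (QuotientAddGroup.eq_zero_iff m).2 hm, AddChar.map_zero_eq_one]

/-- A subset of the plane `R²` which meets every line in direction `v` in at most `B` points,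
counted with parameter, has at most `|R| B` elements. -/
theorem card_le_of_forall_line [Fintype R] {N : ℝ} (hN : (Fintype.card R : ℝ) = N)
    (P : R × R → Prop) (v : R × R) {B : ℝ}
    (hB : ∀ w, (Nat.card {a : R // P (w + a • v)} : ℝ) ≤ B) :
    (Nat.card {w // P w} : ℝ) ≤ N * B := by
  have h1 : Nat.card ({w // P w} × R) = Nat.card (Σ w : R × R, {a : R // P (w + a • v)}) := by
    refine Nat.card_congr
      { toFun := fun z ↦ ⟨z.1.1 - z.2 • v, z.2, by simpa using z.1.2⟩
        invFun := fun z ↦ (⟨z.1 + z.2.1 • v, z.2.2⟩, z.2.1)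
        left_inv := fun z ↦ by simp
        right_inv := fun z ↦ Sigma.subtype_ext (by simp) rfl }
  rw [Nat.card_prod, Nat.card_sigma] at h1
  have h2 : (Nat.card {w // P w} : ℝ) * Fintype.card R =
      ∑ w : R × R, (Nat.card {a : R // P (w + a • v)} : ℝ) := by
    rw [← Nat.card_eq_fintype_card]; exact_mod_cast h1
  have hN0 : 0 < N := by rw [← hN]; exact_mod_cast Fintype.card_pos
  rw [hN] at h2
  refine le_of_mul_le_mul_right (h2.trans_le ?_) hN0
  refine (Finset.sum_le_sum fun w _ ↦ hB w).trans_eq ?_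
  rw [Finset.sum_const, Finset.card_univ, Fintype.card_prod, nsmul_eq_mul, Nat.cast_mul, hN]
  ring

end CongruenceLayer

namespace IsFiniteChainRing

variable {R : Type*} [CommRing R] {π : R} {e q p e₀ : ℕ}

/-- Multiplication by `p` raises the valuation by `e₀`, so a power of `p` brings the valuation of
`x` into any window of length `e₀` above it. -/
theorem exists_natCast_mul_eq {u₀ : Rˣ} (hpπ : (p : R) = u₀ * π ^ e₀) (he₀ : 1 ≤ e₀)
    (hR : IsFiniteChainRing R π e q) {r₀ : ℕ} {x : R} (hx : ¬ π ^ r₀ ∣ x) :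
    ∃ (n : ℕ) (u : Rˣ) (r : ℕ), (n : R) * x = u * π ^ r ∧ r₀ ≤ r ∧ r < r₀ + e₀ := by
  obtain ⟨u, k, rfl⟩ := hR.exists_unit_mul_pow x
  have hk : k < r₀ := by
    by_contra! h
    exact hx ((pow_dvd_pow π h).mul_left _)
  set j := (r₀ - k + e₀ - 1) / e₀ with hj
  have h1 : e₀ * j ≤ r₀ - k + e₀ - 1 := Nat.mul_div_le _ _
  have h2 : r₀ - k + e₀ - 1 < e₀ * j + e₀ := Nat.lt_mul_div_succ _ he₀
  refine ⟨p ^ j, u₀ ^ j * u, e₀ * j + k, ?_, by omega, by omega⟩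
  push_cast
  rw [hpπ, mul_pow, ← pow_mul, pow_add]
  ring

/-- The equation `ψ (y N(v)) = 1` restricted to the line `w + R v₀` is quadratic in the parameter,
with leading coefficient given by `a ↦ ψ (y a N(v₀))`. -/
theorem card_line_le [Fintype R] (hR : IsFiniteChainRing R π e q) (hp : p.Prime)
    (hpq : p ≤ q) (he₀ : 1 ≤ e₀) {u₀ : Rˣ} (hpπ : (p : R) = u₀ * π ^ e₀)
    {ψ : AddChar (Matrix (Fin 2) (Fin 2) R) ℂ} {r : ℕ} (hr : r + 1 ≤ e) {y : R} {u : Rˣ}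
    (hy : y = u * π ^ r) {v₀ : R × R} {s : R}
    (hψ : ψ ((π ^ (e - 1) * s) • nilpotentOf v₀) ≠ 1) (w : R × R) :
    (Nat.card {a : R // ψ (y • nilpotentOf (w + a • v₀)) = 1} : ℝ) ≤
      (q : ℝ) ^ e * ((e + 1) * (p : ℝ) ^ ((1 - ((e - r : ℕ) : ℝ) / e₀) / 2)) := by
  let L : Matrix (Fin 2) (Fin 2) R → R →+ Matrix (Fin 2) (Fin 2) R := fun N ↦
    AddMonoidHom.mk' (fun a ↦ (y * a) • N) fun a b ↦ by rw [mul_add, add_smul]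
  have hψ1 : ψ (y • nilpotentOf w) ^ p ^ e = 1 := by
    have h0 : p ^ e • (y • nilpotentOf w) = 0 := by
      rw [← Nat.cast_smul_eq_nsmul R, Nat.cast_pow, hR.cast_pow_eq_zero he₀ hpπ, zero_smul]
    rw [← AddChar.map_nsmul_eq_pow, h0, AddChar.map_zero_eq_one]
  have hfun : ∀ a : R, ψ (y • nilpotentOf (w + a • v₀)) = ψ (y • nilpotentOf w) *
      (ψ.compAddMonoidHom (L (nilpotentPolar w v₀)) a *
        ψ.compAddMonoidHom (L (nilpotentOf v₀)) (a * a)) := by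
    intro a
    rw [nilpotentOf_add_smul, smul_add, smul_add, AddChar.map_add_eq_mul, AddChar.map_add_eq_mul,
      smul_smul, smul_smul]
    rfl
  simp only [hfun]
  refine hR.card_quadratic_le hp hpq he₀ hpπ _ _ hψ1 (d := e - r) (b₀ := ↑u⁻¹ * s)
    (by omega) (by omega) ?_
  have harg : y * (π ^ (e - r - 1) * (↑u⁻¹ * s)) = π ^ (e - 1) * s := by
    have h1 : π ^ (e - 1) = π ^ r * π ^ (e - r - 1) := by rw [← pow_add]; congr 1; omega
    rw [hy, h1]
    linear_combination (π ^ r * π ^ (e - r - 1) * s) * u.mul_inv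
  change ψ ((y * (π ^ (e - r - 1) * (↑u⁻¹ * s))) • nilpotentOf v₀) ≠ 1
  rwa [harg]

/-- For `x` of valuation below `e / 2`, few vectors `v` satisfy `1 + x N(v) ∈ H`. -/
theorem card_unipotentOf_mem_le [Fintype R] (hR : IsFiniteChainRing R π e q) (hp : p.Prime)
    (hpq : p ≤ q) (he₀ : 1 ≤ e₀) (he : 2 * e₀ < e) {u₀ : Rˣ} (hpπ : (p : R) = u₀ * π ^ e₀)
    {H : Subgroup SL(2, R)} {k : SL(2, R)} (hk : k ∉ H)
    (hkπ : ∀ i j, π ^ (e - 1) ∣ ((k : Matrix (Fin 2) (Fin 2) R) - 1) i j)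
    {x : R} (hx : ¬ π ^ ((e + 1) / 2) ∣ x) :
    (Nat.card {v : R × R // unipotentOf x v ∈ H} : ℝ) ≤
      (q : ℝ) ^ (2 * e) * ((e + 1) * (p : ℝ) ^ (1 - (e : ℝ) / (4 * e₀))) := by
  have hp1 : (1 : ℝ) ≤ p := by exact_mod_cast hp.one_le
  have hp0 : (0 : ℝ) < p := by linarith
  have hq0 : (0 : ℝ) < q := by exact_mod_cast hp.pos.trans_le hpq
  have hcard : (Fintype.card R : ℝ) = (q : ℝ) ^ e := by
    rw [← Nat.card_eq_fintype_card, hR.card_eq]; push_cast; rfl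
  set r₀ := (e + 1) / 2 with hr₀
  have hre : e ≤ 2 * r₀ := by omega
  obtain ⟨v₀, s, hs⟩ := exists_smul_nilpotentOf_notMem hre (by omega)
    hR.pow_eq_zero hk hkπ
  obtain ⟨ψ, hψM, hψs⟩ := exists_addChar_eq_one_of_notMem _ hs
  obtain ⟨n, u, r, hnx, hr, hr'⟩ := exists_natCast_mul_eq hpπ he₀ hR hx
  have hre' : r + 1 ≤ e := by omega
  have hline : ∀ w : R × R,
      (Nat.card {a : R // ψ ((n * x) • nilpotentOf (w + a • v₀)) = 1} : ℝ) ≤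
        (q : ℝ) ^ e * ((e + 1) * (p : ℝ) ^ ((1 - ((e - r : ℕ) : ℝ) / e₀) / 2)) := fun w ↦
    hR.card_line_le hp hpq he₀ hpπ hre' hnx hψs w
  have hmem : ∀ v : R × R, unipotentOf x v ∈ H → ψ ((n * x) • nilpotentOf v) = 1 := by
    intro v hv
    refine hψM _ (smul_nilpotentOf_mem hre hR.pow_eq_zero ?_ ?_)
    · rw [hnx]
      exact (pow_dvd_pow π hr).mul_left _
    · rw [← unipotentOf_pow]
      exact H.pow_mem hv n
  have hsub : (Nat.card {v : R × R // unipotentOf x v ∈ H} : ℝ) ≤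
      Nat.card {v : R × R // ψ ((n * x) • nilpotentOf v) = 1} :=
    Nat.cast_le.2 (Nat.card_le_card_of_injective
      (Subtype.map id hmem) (Subtype.map_injective hmem Function.injective_id))
  have hfin : (Nat.card {v : R × R // ψ ((n * x) • nilpotentOf v) = 1} : ℝ) ≤
      (q : ℝ) ^ e * ((q : ℝ) ^ e * ((e + 1) * (p : ℝ) ^ ((1 - ((e - r : ℕ) : ℝ) / e₀) / 2))) :=
    card_le_of_forall_line hcard (fun v ↦ ψ ((n * x) • nilpotentOf v) = 1) v₀ hline
  have hexp : (p : ℝ) ^ ((1 - ((e - r : ℕ) : ℝ) / e₀) / 2) ≤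
      (p : ℝ) ^ (1 - (e : ℝ) / (4 * e₀)) := by
    apply Real.rpow_le_rpow_of_exponent_le hp1
    have he0 : (0 : ℝ) < e₀ := by exact_mod_cast he₀
    have h1 : e ≤ 2 * (e - r) + 2 * e₀ := by omega
    have h2 : (e : ℝ) ≤ 2 * (e - r : ℕ) + 2 * e₀ := by exact_mod_cast h1
    have h3 : (e : ℝ) / e₀ ≤ 2 * ((e - r : ℕ) / e₀) + 2 := by
      rw [div_le_iff₀ he0]
      field_simp
      linarith
    have h4 : (e : ℝ) / (4 * e₀) = e / e₀ / 4 := by rw [div_div, mul_comm]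
    rw [h4]
    linarith
  refine hsub.trans (hfin.trans ?_)
  rw [two_mul, pow_add, mul_assoc ((q : ℝ) ^ e)]
  gcongr

/-- At least half of the elements of `R` are units, whence `|SL(2, R)| ≥ q ^ (3 e) / 2`. -/
theorem two_mul_card_SL_ge [Finite R] (hR : IsFiniteChainRing R π e q) (he : 1 ≤ e) (hq : 2 ≤ q) :
    q ^ (3 * e) ≤ 2 * Nat.card SL(2, R) := by
  have h1 : Nat.card R ≤ Nat.card Rˣ + Nat.card {x : R // π ^ 1 ∣ x} := by
    rw [← Nat.card_sum]
    refine Nat.card_le_card_of_surjective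
      (Sum.elim (fun u : Rˣ ↦ (u : R)) (fun x : {x : R // π ^ 1 ∣ x} ↦ x.1)) fun x ↦ ?_
    obtain ⟨u, k, rfl⟩ := hR.exists_unit_mul_pow x
    rcases k with _ | k
    · exact ⟨Sum.inl u, by simp⟩
    · exact ⟨Sum.inr ⟨_, (pow_dvd_pow π (by omega)).mul_left _⟩, rfl⟩
  have h2 := hR.card_dvd_le 1 he
  have h3 : 2 * q ^ (e - 1) ≤ q ^ e := by
    obtain ⟨e, rfl⟩ := Nat.exists_eq_add_of_le' he
    rw [Nat.add_sub_cancel, pow_succ']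
    gcongr
  rw [hR.card_eq] at h1
  have h4 : q ^ e ≤ 2 * Nat.card Rˣ := by omega
  have h5 := card_units_mul_le_card_SL (R := R)
  rw [hR.card_eq] at h5
  calc q ^ (3 * e) = q ^ e * (q ^ e * q ^ e) := by rw [← pow_add, ← pow_add]; congr 1; omega
    _ ≤ 2 * Nat.card Rˣ * (q ^ e * q ^ e) := Nat.mul_le_mul_right _ h4
    _ ≤ 2 * Nat.card SL(2, R) := by rw [mul_assoc]; exact Nat.mul_le_mul_left _ h5

/-- The orbit bound over a finite chain ring: the upper unipotent elements with entry `x`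
divisible by `π ^ ⌈e / 2⌉` contribute the first term, all others the second. -/
theorem card_orbits_div_index_le [Finite R] (hR : IsFiniteChainRing R π e q) (hp : p.Prime)
    (hpq : p ≤ q) (he₀ : 1 ≤ e₀) (he : 2 * e₀ < e) {u₀ : Rˣ} (hpπ : (p : R) = u₀ * π ^ e₀)
    {H : Subgroup SL(2, R)} {k : SL(2, R)} (hk : k ∉ H)
    (hkπ : ∀ i j, π ^ (e - 1) ∣ ((k : Matrix (Fin 2) (Fin 2) R) - 1) i j) :
    (Nat.card (MulAction.orbitRel.Quotient H (SL(2, R) ⧸ upperUnipotent R)) : ℝ) / H.index ≤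
      (p : ℝ) ^ (-(e : ℝ) / 2) + 2 * ((e + 1) * (p : ℝ) ^ (1 - (e : ℝ) / (4 * e₀))) := by
  classical
  have : Fintype R := Fintype.ofFinite R
  have hp1 : (1 : ℝ) ≤ p := by exact_mod_cast hp.one_le
  have hp0 : (0 : ℝ) < p := by linarith
  have hpq' : (p : ℝ) ≤ q := by exact_mod_cast hpq
  have hq0 : (0 : ℝ) < q := hp0.trans_le hpq'
  set C : ℝ := (e + 1) * (p : ℝ) ^ (1 - (e : ℝ) / (4 * e₀)) with hC
  have hC0 : 0 ≤ C := by positivity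
  set g : ℝ := (Nat.card SL(2, R) : ℝ) with hg
  have hg0 : 0 < g := by rw [hg]; exact_mod_cast Nat.card_pos
  set r₀ := (e + 1) / 2 with hr₀
  have hterm : ∀ x : R, (Nat.card {g : SL(2, R) // unipotentOf x (firstCol g) ∈ H} : ℝ) ≤
      (if π ^ r₀ ∣ x then g else 0) + (q : ℝ) ^ (3 * e) * C := by
    intro x
    split_ifs with hx
    · refine le_add_of_le_of_nonneg ?_ (by positivity)
      exact Nat.cast_le.2 (Nat.card_le_card_of_injective _ Subtype.val_injective)
    · have h1 := card_firstCol_mem_le {v : R × R | unipotentOf x v ∈ H}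
      rw [hR.card_eq] at h1
      have h2 : (Nat.card {g : SL(2, R) // unipotentOf x (firstCol g) ∈ H} : ℝ) ≤
          Nat.card {v : R × R // unipotentOf x v ∈ H} * (q : ℝ) ^ e := by exact_mod_cast h1
      have h3 := hR.card_unipotentOf_mem_le hp hpq he₀ he hpπ hk hkπ hx
      rw [zero_add]
      refine h2.trans ((mul_le_mul_of_nonneg_right h3 (by positivity)).trans_eq ?_)
      rw [show 3 * e = 2 * e + e by ring, pow_add]
      ring
  have hsum : (∑ x : R, Nat.card {g : SL(2, R) // unipotentOf x (firstCol g) ∈ H} : ℝ) ≤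
      (q : ℝ) ^ (e - r₀) * g + (q : ℝ) ^ e * ((q : ℝ) ^ (3 * e) * C) := by
    refine (Finset.sum_le_sum fun x _ ↦ hterm x).trans ?_
    rw [Finset.sum_add_distrib, Finset.sum_ite, Finset.sum_const_zero, add_zero, Finset.sum_const,
      Finset.sum_const, nsmul_eq_mul, nsmul_eq_mul, Finset.card_univ, ← Fintype.card_subtype,
      ← Nat.card_eq_fintype_card, ← Nat.card_eq_fintype_card, hR.card_eq, Nat.cast_pow]
    gcongr
    exact_mod_cast hR.card_dvd_le r₀ (by omega)
  have horb := card_orbits_mul_le_sum H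
  rw [hR.card_eq] at horb
  set N : ℝ := (Nat.card (MulAction.orbitRel.Quotient H (SL(2, R) ⧸ upperUnipotent R)) : ℝ) with hN
  have hH0 : (0 : ℝ) < Nat.card H := by exact_mod_cast Nat.card_pos
  have hidx : (Nat.card H : ℝ) * H.index = g := by rw [hg]; exact_mod_cast H.card_mul_index
  have hidx0 : (0 : ℝ) < H.index := by
    exact_mod_cast Nat.pos_of_ne_zero Subgroup.index_ne_zero_of_finite
  have hN1 : N * Nat.card H * (q : ℝ) ^ e ≤
      (q : ℝ) ^ (e - r₀) * g + (q : ℝ) ^ e * ((q : ℝ) ^ (3 * e) * C) :=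
    le_trans (by rw [hN]; exact_mod_cast horb) hsum
  have hg2 : (q : ℝ) ^ (3 * e) ≤ 2 * g := by
    rw [hg]; exact_mod_cast hR.two_mul_card_SL_ge (by omega) (hp.two_le.trans hpq)
  have hq1 : (q : ℝ) ^ (e - r₀) ≤ (q : ℝ) ^ e * (p : ℝ) ^ (-(e : ℝ) / 2) := by
    rw [pow_sub₀ _ hq0.ne' (by omega)]
    gcongr
    have h1 : ((p : ℝ) ^ r₀)⁻¹ ≤ (p : ℝ) ^ (-(e : ℝ) / 2) := by
      rw [← Real.rpow_natCast, ← Real.rpow_neg hp0.le]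
      apply Real.rpow_le_rpow_of_exponent_le hp1
      have : (e : ℝ) ≤ 2 * r₀ := by exact_mod_cast (by omega : e ≤ 2 * r₀)
      linarith
    refine le_trans ?_ h1
    gcongr
  have hqe : (0 : ℝ) < (q : ℝ) ^ e := by positivity
  have hN2 : N * Nat.card H ≤ ((p : ℝ) ^ (-(e : ℝ) / 2) + 2 * C) * g := by
    refine le_of_mul_le_mul_right (hN1.trans ?_) hqe
    have h1 := mul_le_mul_of_nonneg_right hq1 hg0.le
    have h2 := mul_le_mul_of_nonneg_left (mul_le_mul_of_nonneg_right hg2 hC0) hqe.le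
    linarith
  rw [div_le_iff₀ hidx0]
  refine le_of_mul_le_mul_right (hN2.trans_eq ?_) hH0
  rw [← hidx]; ring

end IsFiniteChainRing

/-! ### Quotients of a Dedekind domain by prime powers -/

section PrimePower

variable {A : Type*} [CommRing A]

theorem Ideal.Quotient.pow_dvd_mk_of_mem_pow {P I : Ideal A} {a : A} (ha : I ⊔ Ideal.span {a} = P)
    {m : ℕ} {x : A} (hx : x ∈ P ^ m) : Ideal.Quotient.mk I a ^ m ∣ Ideal.Quotient.mk I x := by
  have h1 : P.map (Ideal.Quotient.mk I) = Ideal.span {Ideal.Quotient.mk I a} := by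
    rw [← ha, Ideal.map_sup, Ideal.map_quotient_self, bot_sup_eq, Ideal.map_span,
      Set.image_singleton]
  have h2 := Ideal.mem_map_of_mem (Ideal.Quotient.mk I) hx
  rwa [Ideal.map_pow, h1, Ideal.span_singleton_pow, Ideal.mem_span_singleton] at h2

theorem Ideal.Quotient.isUnit_mk_of_notMem {P : Ideal A} [P.IsMaximal] {x : A} (hx : x ∉ P)
    (e : ℕ) : IsUnit (Ideal.Quotient.mk (P ^ e) x) := by
  obtain ⟨y, i, hi, h⟩ := Ideal.IsMaximal.exists_inv_pow P hx e
  refine IsUnit.of_mul_eq_one (Ideal.Quotient.mk (P ^ e) y) ?_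
  have := congrArg (Ideal.Quotient.mk (P ^ e)) h
  rwa [map_add, map_mul, map_one, Ideal.Quotient.eq_zero_iff_mem.2 hi, add_zero, mul_comm] at this

/-- A generator `a` of `P` modulo `P ^ e` is a uniformizer of `A ⧸ P ^ e`. -/
theorem isFiniteChainRing_quotient_pow [IsDedekindDomain A] {P : Ideal A} [P.IsMaximal]
    (hP : P ≠ ⊥) {e : ℕ} (he : 1 ≤ e) [Finite (A ⧸ P ^ e)] {a : A}
    (ha : P ^ e ⊔ Ideal.span {a} = P) :
    IsFiniteChainRing (A ⧸ P ^ e) (Ideal.Quotient.mk (P ^ e) a) e (Nat.card (A ⧸ P)) := by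
  have haP : a ∈ P := ha ▸ Ideal.mem_sup_right (Ideal.mem_span_singleton_self a)
  have hpow : ∀ m, Nat.card (A ⧸ P ^ m) = Nat.card (A ⧸ P) ^ m := fun m ↦ by
    simpa only [Submodule.cardQuot_apply] using cardQuot_pow_of_prime (P := P) hP (i := m)
  have hzero : Ideal.Quotient.mk (P ^ e) a ^ e = 0 := by
    rw [← map_pow]; exact Ideal.Quotient.eq_zero_iff_mem.2 (Ideal.pow_mem_pow haP e)
  refine ⟨hzero, fun x ↦ ?_, hpow e, fun m hm ↦ ?_⟩
  · have hstep : ∀ n : ℕ, ∀ x : A ⧸ P ^ e, (∃ (u : (A ⧸ P ^ e)ˣ) (k : ℕ),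
        x = u * Ideal.Quotient.mk (P ^ e) a ^ k) ∨ Ideal.Quotient.mk (P ^ e) a ^ n ∣ x := by
      intro n
      induction n with
      | zero => exact fun x ↦ Or.inr (by simp)
      | succ n ih =>
        intro x
        obtain ⟨x, rfl⟩ := Ideal.Quotient.mk_surjective x
        by_cases hx : x ∈ P
        · obtain ⟨y, hy⟩ := Ideal.Quotient.pow_dvd_mk_of_mem_pow ha (m := 1) (by rwa [pow_one])
          rw [hy, pow_one]
          rcases ih y with ⟨u, k, rfl⟩ | h
          · exact Or.inl ⟨u, k + 1, by ring⟩
          · exact Or.inr (by rw [pow_succ']; exact mul_dvd_mul_left _ h)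
        · exact Or.inl ⟨(Ideal.Quotient.isUnit_mk_of_notMem hx e).unit, 0, by simp⟩
    rcases hstep e x with h | h
    · exact h
    · rw [hzero, zero_dvd_iff] at h
      exact ⟨1, e, by rw [h, hzero, mul_zero]⟩
  · let f := Ideal.Quotient.factor (Ideal.pow_le_pow_right hm : P ^ e ≤ P ^ m)
    have hf : Function.Surjective f := Ideal.Quotient.factor_surjective _
    have h1 := f.toAddMonoidHom.ker.card_eq_card_quotient_mul_card_addSubgroup
    rw [Nat.card_congr (QuotientAddGroup.quotientKerEquivOfSurjective f.toAddMonoidHom hf).toEquiv,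
      hpow, hpow] at h1
    have hq : 0 < Nat.card (A ⧸ P) := by
      have : 0 < Nat.card (A ⧸ P) ^ e := hpow e ▸ Nat.card_pos
      exact Nat.pos_of_ne_zero fun h ↦ by
        rw [h, zero_pow (by omega)] at this
        exact this.false
    have h2 : Nat.card f.toAddMonoidHom.ker = Nat.card (A ⧸ P) ^ (e - m) := by
      refine Nat.eq_of_mul_eq_mul_left (pow_pos hq m) ?_
      rw [← h1, ← pow_add]; congr 1; omega
    rw [← h2]
    refine Nat.card_le_card_of_injective (fun x ↦ ⟨x.1, ?_⟩) fun x y h ↦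
      Subtype.ext (congrArg (fun z ↦ z.1) h)
    obtain ⟨y, hy⟩ := x.2
    change f x.1 = 0
    rw [hy, map_mul, map_pow, Ideal.Quotient.factor_mk, ← map_pow,
      Ideal.Quotient.eq_zero_iff_mem.2 (Ideal.pow_mem_pow haP m), zero_mul]

theorem exists_unit_mk_eq_mul_pow {P : Ideal A} [P.IsMaximal] {e n : ℕ} (hn : n < e) {a : A}
    (ha : P ^ e ⊔ Ideal.span {a} = P) {x : A} (hx : x ∈ P ^ n) (hx' : x ∉ P ^ (n + 1)) :
    ∃ u : (A ⧸ P ^ e)ˣ, Ideal.Quotient.mk (P ^ e) x = u * Ideal.Quotient.mk (P ^ e) a ^ n := by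
  have haP : a ∈ P := ha ▸ Ideal.mem_sup_right (Ideal.mem_span_singleton_self a)
  obtain ⟨y, hy⟩ := Ideal.Quotient.pow_dvd_mk_of_mem_pow ha hx
  obtain ⟨y, rfl⟩ := Ideal.Quotient.mk_surjective y
  have hyP : y ∉ P := by
    intro h
    rw [← map_pow, ← map_mul, Ideal.Quotient.eq] at hy
    have h1 := Ideal.mul_mem_mul (Ideal.pow_mem_pow haP n) h
    rw [← pow_succ] at h1
    exact hx' (by simpa using add_mem (Ideal.pow_le_pow_right hn hy) h1)
  exact ⟨(Ideal.Quotient.isUnit_mk_of_notMem hyP e).unit, by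
    rw [hy, IsUnit.unit_spec, mul_comm]⟩

end PrimePower

/-! ### Number fields -/

section Local

variable {K : Type*} [Field K]

/-- A subgroup of exact level `e > 1` does not contain the kernel of reduction modulo `𝔭 ^ (e -
1)`. -/
theorem HasExactLevel.exists_notMem {𝔭 : Ideal (𝓞 K)} {e : ℕ} (he : 1 < e)
    {H : Subgroup (LocalSL 𝔭 e)} (hH : HasExactLevel 𝔭 e H) :
    ∃ k ∉ H, reductionMap 𝔭 (Nat.sub_le e 1) k = 1 := by
  by_contra! hall
  refine hH.1 he (le_antisymm (Subgroup.le_comap_map _ _) fun g hg ↦ ?_)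
  obtain ⟨h, hh, hgh⟩ := hg
  have h1 : h⁻¹ * g ∈ H := by
    by_contra hn
    exact hall _ hn (by rw [map_mul, map_inv, hgh, inv_mul_cancel])
  simpa using H.mul_mem hh h1

theorem pow_dvd_of_reductionMap_eq_one {𝔭 : Ideal (𝓞 K)} {e : ℕ} {a : 𝓞 K}
    (ha : 𝔭 ^ e ⊔ Ideal.span {a} = 𝔭) {k : LocalSL 𝔭 e}
    (hk : reductionMap 𝔭 (Nat.sub_le e 1) k = 1) (i j : Fin 2) :
    Ideal.Quotient.mk (𝔭 ^ e) a ^ (e - 1) ∣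
      ((k : Matrix (Fin 2) (Fin 2) (LocalRing 𝔭 e)) - 1) i j := by
  have h1 : Ideal.Quotient.factor (Ideal.pow_le_pow_right (Nat.sub_le e 1))
      (((k : Matrix (Fin 2) (Fin 2) (LocalRing 𝔭 e)) - 1) i j) = 0 := by
    have := congrArg (fun g : LocalSL 𝔭 (e - 1) ↦
      (g : Matrix (Fin 2) (Fin 2) (LocalRing 𝔭 (e - 1))) i j) hk
    simp only [reductionMap, Matrix.SpecialLinearGroup.map_apply_coe, RingHom.mapMatrix_apply,
      Matrix.map_apply, Matrix.SpecialLinearGroup.coe_one] at this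
    rw [Matrix.sub_apply, map_sub, this, Matrix.one_apply, Matrix.one_apply]
    split_ifs <;> simp
  obtain ⟨x, hx⟩ := Ideal.Quotient.mk_surjective
    (((k : Matrix (Fin 2) (Fin 2) (LocalRing 𝔭 e)) - 1) i j)
  rw [← hx, Ideal.Quotient.factor_mk, Ideal.Quotient.eq_zero_iff_mem] at h1
  rw [← hx]
  exact Ideal.Quotient.pow_dvd_mk_of_mem_pow ha h1

variable [NumberField K]

theorem natCast_mem_pow_ramificationIdx {p : ℕ} (hp : p.Prime) {𝔭 : Ideal (𝓞 K)} [𝔭.IsPrime]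
    [𝔭.LiesOver (Ideal.span {(p : ℤ)})] :
    (p : 𝓞 K) ∈ 𝔭 ^ 𝔭.ramificationIdx ℤ ∧ (p : 𝓞 K) ∉ 𝔭 ^ (𝔭.ramificationIdx ℤ + 1) := by
  have hmap : (Ideal.span {(p : ℤ)}).map (algebraMap ℤ (𝓞 K)) = Ideal.span {(p : 𝓞 K)} := by
    rw [Ideal.map_span, Set.image_singleton]; simp
  have hp0 : Ideal.span {(p : 𝓞 K)} ≠ ⊥ := by
    simpa using hp.ne_zero
  have h𝔭0 : 𝔭 ≠ ⊥ := by
    rw [← hmap] at hp0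
    exact ne_bot_of_le_ne_bot hp0 (Ideal.map_le_of_le_comap
      (𝔭.over_def (Ideal.span {(p : ℤ)})).le)
  rw [Ideal.IsDedekindDomain.ramificationIdx_eq_multiplicity (Ideal.span {(p : ℤ)}) 𝔭 (hmap ▸ hp0), hmap,
    ← Ideal.dvd_span_singleton, ← Ideal.dvd_span_singleton]
  exact ⟨pow_multiplicity_dvd _ _, (FiniteMultiplicity.of_prime_left
    (Ideal.prime_of_isPrime h𝔭0 inferInstance) hp0).not_pow_dvd_of_multiplicity_lt
      (Nat.lt_succ_self _)⟩

theorem le_card_quotient_of_liesOver {p : ℕ} (hp : p.Prime) {𝔭 : Ideal (𝓞 K)} [𝔭.IsMaximal]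
    (h : (p : 𝓞 K) ∈ 𝔭) : p ≤ Nat.card (𝓞 K ⧸ 𝔭) := by
  have : Fact p.Prime := ⟨hp⟩
  have h0 : p • (1 : 𝓞 K ⧸ 𝔭) = 0 := by
    rw [nsmul_eq_mul, mul_one, ← map_natCast (Ideal.Quotient.mk 𝔭)]
    exact Ideal.Quotient.eq_zero_iff_mem.2 h
  rw [← addOrderOf_eq_prime h0 one_ne_zero]
  exact Nat.le_of_dvd Nat.card_pos (addOrderOf_dvd_natCard _)

/-- The uniform estimate, valid for all primes `p`, from which the explicit bounds are read off.
-/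
theorem localChi_le {p : ℕ} (hp : p.Prime) {𝔭 : Ideal (𝓞 K)} [𝔭.IsPrime]
    [𝔭.LiesOver (Ideal.span {(p : ℤ)})] {e : ℕ} (he : 2 * 𝔭.ramificationIdx ℤ < e)
    {H : Subgroup (LocalSL 𝔭 e)} (hH : HasExactLevel 𝔭 e H) :
    p ≤ Nat.card (𝓞 K ⧸ 𝔭) ∧ localChi 𝔭 e H ≤ (p : ℝ) ^ (-(e : ℝ) / 2) +
      2 * ((e + 1) * (p : ℝ) ^ (1 - (e : ℝ) / (4 * 𝔭.ramificationIdx ℤ))) := by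
  obtain ⟨hmem, hnotMem⟩ := natCast_mem_pow_ramificationIdx (K := K) hp (𝔭 := 𝔭)
  have he₀ : 1 ≤ 𝔭.ramificationIdx ℤ := Ideal.ramificationIdx_pos 𝔭 ℤ
  have hp𝔭 : (p : 𝓞 K) ∈ 𝔭 := Ideal.pow_le_self (by omega) hmem
  have h𝔭0 : 𝔭 ≠ ⊥ := by
    rintro rfl
    exact hp.ne_zero (by simpa using hp𝔭)
  have : 𝔭.IsMaximal := Ideal.IsPrime.isMaximal ‹_› h𝔭0
  have hpq : p ≤ Nat.card (𝓞 K ⧸ 𝔭) := le_card_quotient_of_liesOver hp hp𝔭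
  have : Finite (𝓞 K ⧸ 𝔭 ^ e) :=
    (𝔭 ^ e).finiteQuotientOfFreeOfNeBot (pow_ne_zero e h𝔭0)
  obtain ⟨a, ha⟩ := IsDedekindDomain.exists_sup_span_eq
    (Ideal.pow_le_self (by omega) : 𝔭 ^ e ≤ 𝔭) (pow_ne_zero e h𝔭0)
  obtain ⟨u, hu⟩ := exists_unit_mk_eq_mul_pow (by omega) ha hmem hnotMem
  rw [map_natCast] at hu
  obtain ⟨k, hk, hk1⟩ := hH.exists_notMem (by omega)
  exact ⟨hpq, (isFiniteChainRing_quotient_pow h𝔭0 (by omega) ha).card_orbits_div_index_le hp hpq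
    he₀ he hu hk (pow_dvd_of_reductionMap_eq_one ha hk1)⟩

end Local

theorem mainTheorem3 {K : Type*} [Field K] [NumberField K]
    (p : ℕ) (hp : p.Prime) (𝔭 : Ideal (𝓞 K)) (h𝔭 : 𝔭.IsPrime)
    (hover : 𝔭.LiesOver (Ideal.span {(p : ℤ)}))
    (q e₀ : ℕ) (hq : q = Nat.card (𝓞 K ⧸ 𝔭)) (he₀ : e₀ = 𝔭.ramificationIdx ℤ)
    (e : ℕ) (he : 1 ≤ e) (H : Subgroup (LocalSL 𝔭 e)) (hH : HasExactLevel 𝔭 e H) :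
    (3 ≤ p → 2 * e₀ ^ 2 + 3 * e₀ + 4 ≤ e →
      localChi 𝔭 e H ≤
        (q : ℝ) * ((q : ℝ) ^ 2 - 1) *
          ((q : ℝ) ^ (-(e : ℝ)) + 2 * (q : ℝ) ^ (1 - (e : ℝ)) +
            (q : ℝ) ^ 2 * (e : ℝ) ^ (3 / 2 : ℝ) *
              (p : ℝ) ^ (-(((e : ℝ) - 3) / (6 + 4 * (e₀ : ℝ)))))) ∧
    (p = 2 → 36 * e₀ + 13 < e →
      localChi 𝔭 e H ≤
        (q : ℝ) ^ (6 * e₀ + 1) * ((q : ℝ) ^ 2 - 1) *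
          ((q : ℝ) ^ (-(e : ℝ)) + 2 * (q : ℝ) ^ (1 - (e : ℝ)) +
            4 * (q : ℝ) ^ (2 + (e₀ : ℝ) / 2) * (e : ℝ) ^ (3 / 2 : ℝ) *
              (p : ℝ) ^ (-(((e : ℝ) - 37 * (e₀ : ℝ)) / (18 + 34 * (e₀ : ℝ)))))) := by
  have he₀1 : 1 ≤ e₀ := he₀ ▸ Ideal.ramificationIdx_pos 𝔭 ℤ
  have hmain : 2 * e₀ < e → p ≤ q ∧ localChi 𝔭 e H ≤ (p : ℝ) ^ (-(e : ℝ) / 2) +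
      2 * ((e + 1) * (p : ℝ) ^ (1 - (e : ℝ) / (4 * e₀))) := by
    subst hq he₀
    exact fun h ↦ localChi_le hp h hH
  have he1 : (1 : ℝ) ≤ e := by exact_mod_cast he
  have he0r : (1 : ℝ) ≤ e₀ := by exact_mod_cast he₀1
  have hp2 : (2 : ℝ) ≤ p := by exact_mod_cast hp.two_le
  have hp0 : (0 : ℝ) < p := by linarith
  have hepow : (e : ℝ) ≤ (e : ℝ) ^ (3 / 2 : ℝ) := by
    simpa using Real.rpow_le_rpow_of_exponent_le he1 (by norm_num : (1 : ℝ) ≤ 3 / 2)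
  -- any exponent `s` below both exponents of the estimate gives a common bound
  have hbound : 2 * e₀ < e → ∀ s : ℝ, s ≤ e / 2 → s ≤ e / (4 * e₀) →
      localChi 𝔭 e H ≤ 5 * p * (e : ℝ) ^ (3 / 2 : ℝ) * (p : ℝ) ^ (-s) := by
    intro h s hs1 hs2
    refine (hmain h).2.trans ?_
    have h1 : (p : ℝ) ^ (-(e : ℝ) / 2) ≤ (p : ℝ) ^ (-s) :=
      Real.rpow_le_rpow_of_exponent_le (by linarith) (by linarith)
    have h2 : (p : ℝ) ^ (1 - (e : ℝ) / (4 * e₀)) ≤ p * (p : ℝ) ^ (-s) := by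
      have : (p : ℝ) * (p : ℝ) ^ (-s) = (p : ℝ) ^ (1 - s) := by
        rw [sub_eq_add_neg, Real.rpow_add hp0, Real.rpow_one]
      rw [this]
      exact Real.rpow_le_rpow_of_exponent_le (by linarith) (by linarith)
    have h3 : ((e : ℝ) + 1) * (p : ℝ) ^ (1 - (e : ℝ) / (4 * e₀)) ≤
        (2 * (e : ℝ) ^ (3 / 2 : ℝ)) * (p * (p : ℝ) ^ (-s)) := by
      gcongr
      linarith
    -- the first term of the estimate is absorbed into the second, as `4 p + p = 5 p`
    have h4 : 1 * (p : ℝ) ^ (-s) ≤ (p * (e : ℝ) ^ (3 / 2 : ℝ)) * (p : ℝ) ^ (-s) := by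
      gcongr
      nlinarith
    linarith
  constructor
  · intro hp3 hge
    have h2e : 2 * e₀ < e := by nlinarith
    obtain ⟨hpq, -⟩ := hmain h2e
    have hp3' : (3 : ℝ) ≤ p := by exact_mod_cast hp3
    have hpq' : (p : ℝ) ≤ q := by exact_mod_cast hpq
    have hq3 : (3 : ℝ) ≤ q := hp3'.trans hpq'
    have hq1 : (8 : ℝ) ≤ (q : ℝ) ^ 2 - 1 := by nlinarith
    refine (hbound h2e (((e : ℝ) - 3) / (6 + 4 * e₀)) ?_ ?_).trans ?_
    · gcongr <;> linarith
    · gcongr <;> linarith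
    · have hA : (5 * p : ℝ) ≤ q * ((q : ℝ) ^ 2 - 1) * (q : ℝ) ^ 2 := by
        have h1 : q * 8 ≤ q * ((q : ℝ) ^ 2 - 1) := by gcongr
        have h2 : (1 : ℝ) ≤ (q : ℝ) ^ 2 := by linarith
        have h3 : q * ((q : ℝ) ^ 2 - 1) ≤ q * ((q : ℝ) ^ 2 - 1) * (q : ℝ) ^ 2 :=
          le_mul_of_one_le_right (by nlinarith) h2
        linarith
      have hB : (0 : ℝ) ≤ (q : ℝ) ^ (-(e : ℝ)) + 2 * (q : ℝ) ^ (1 - (e : ℝ)) := by positivity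
      have hC : (0 : ℝ) ≤ q * ((q : ℝ) ^ 2 - 1) := by nlinarith
      have hD : (0 : ℝ) ≤ (e : ℝ) ^ (3 / 2 : ℝ) * (p : ℝ) ^ (-(((e : ℝ) - 3) / (6 + 4 * e₀))) := by
        positivity
      have h1 := mul_le_mul_of_nonneg_right hA hD
      have h2 := mul_nonneg hC hB
      linarith
  · intro hp2' hge
    have h2e : 2 * e₀ < e := by omega
    obtain ⟨hpq, -⟩ := hmain h2e
    have hpq' : (p : ℝ) ≤ q := by exact_mod_cast hpq
    have hq2 : (2 : ℝ) ≤ q := hp2.trans hpq'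
    have hq1 : (3 : ℝ) ≤ (q : ℝ) ^ 2 - 1 := by nlinarith
    refine (hbound h2e (((e : ℝ) - 37 * e₀) / (18 + 34 * e₀)) ?_ ?_).trans ?_
    · gcongr <;> linarith
    · gcongr <;> linarith
    · have hA : (5 * p : ℝ) ≤ (q : ℝ) ^ (6 * e₀ + 1) * ((q : ℝ) ^ 2 - 1) *
          (4 * (q : ℝ) ^ (2 + (e₀ : ℝ) / 2)) := by
        have h1 : (q : ℝ) ≤ (q : ℝ) ^ (6 * e₀ + 1) := le_self_pow₀ (by linarith) (by omega)
        have h2 : (1 : ℝ) ≤ (q : ℝ) ^ (2 + (e₀ : ℝ) / 2) :=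
          Real.one_le_rpow (by linarith) (by positivity)
        have h3 : (q : ℝ) * 3 * (4 * 1) ≤ (q : ℝ) ^ (6 * e₀ + 1) * ((q : ℝ) ^ 2 - 1) *
          (4 * (q : ℝ) ^ (2 + (e₀ : ℝ) / 2)) := by gcongr
        linarith
      have hB : (0 : ℝ) ≤ (q : ℝ) ^ (-(e : ℝ)) + 2 * (q : ℝ) ^ (1 - (e : ℝ)) := by positivity
      have hC : (0 : ℝ) ≤ (q : ℝ) ^ (6 * e₀ + 1) * ((q : ℝ) ^ 2 - 1) :=
        mul_nonneg (by positivity) (by linarith)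
      have hD : (0 : ℝ) ≤ (e : ℝ) ^ (3 / 2 : ℝ) *
          (p : ℝ) ^ (-(((e : ℝ) - 37 * e₀) / (18 + 34 * e₀))) := by positivity
      have h1 := mul_le_mul_of_nonneg_right hA hD
      have h2 := mul_nonneg hC hB
      linarith
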